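/- Let $n\ge 1$, let $\mathfrak h^*=\{v\in\mathbb C^{n+1}:\sum_i v_i=0\}$ with the standard bilinear form, and let $\alpha_i=\varepsilon_i-\varepsilon_{i+1}$ ($1\le i\le n$) and $\theta=\varepsilon_1-\varepsilon_{n+1}$, where $\varepsilon_1,\dots,\varepsilon_{n+1}$ are the coordinate vectors of $\mathbb C^{n+1}$. Let $\widehat{\mathfrak h}^*=\mathfrak h^*\oplus\mathbb C\Lambda_0\oplus\mathbb C\delta$, with the form extended by $(\Lambda_0,\delta)=1$, $(\Lambda_0,\Lambda_0)=(\delta,\delta)=0$ and $\Lambda_0,\delta\perp\mathfrak h^*$, and let $\alpha_0=\delta-\theta$. The affine Weyl group $\widehat{\mathcal W}$ of type $A_n^{(1)}$ is the group of linear automorphisms of $\widehat{\mathfrak h}^*$ generated by the simple reflections $s_i\lambda=\lambda-(\lambda,\alpha_i)\alpha_i$, $0\le i\le n$. Let $\ell$ be the length function with respect to $s_0,\dots,s_n$, and let $\preceq$ be the Bruhat order, that is, the reflexive and transitive closure of the relation: $v=ut$ with $t$ conjugate to some $s_i$ and $\ell(u)<\ell(v)$. Let $w_o$ be the longest element of the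 finite Weyl group $\mathcal W=\langle s_1,\dots,s_n\rangle$. Put $$s_{n-1,1}=(s_1s_2\cdots s_{n-1})(s_n s_{n-1}\cdots s_1),\qquad w_k=(s_0\,s_{n-1,1})^k\quad(k\ge 0).$$ Then the sequence $(w_k)_{k\ge0}$ is (strictly) increasing for $\preceq$, and it is cofinal in $(\widehat{\mathcal W},\preceq)$: for every $a\in\widehat{\mathcal W}$ there is $k\ge 0$ with $a\preceq w_k$. The same holds for the sequence $(w_ow_k)_{k\ge 0}$: it is (strictly) increasing and cofinal in $(\widehat{\mathcal W},\preceq)$. -/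

import Mathlib

/-! ### Length and Bruhat order with respect to a family of generators -/

section Generators

/-- The length of `g` with respect to the family `s`: the least length of a word in the `s i` with
product `g`. (It is only used for elements that are such products.) -/
noncomputable def genLength {G B : Type*} [Group G] (s : B → G) (g : G) : ℕ :=
  sInf {m | ∃ ω : List B, ω.length = m ∧ (ω.map s).prod = g}

/-- One step of the Bruhat order: `v = u * t` for a reflection `t`, i.e. a conjugate of some `s i`,
and `v` is longer than `u`. -/
def BruhatStep {G B : Type*} [Group G] (s : B → G) (u v : G) : Prop :=
  ∃ (g : G) (i : B), v = u * (g * s i * g⁻¹) ∧ genLength s u < genLength s v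

/-- The Bruhat order: the reflexive transitive closure of `BruhatStep`. -/
def BruhatLE {G B : Type*} [Group G] (s : B → G) : G → G → Prop :=
  Relation.ReflTransGen (BruhatStep s)

theorem BruhatLE.eq_or_genLength_lt {G B : Type*} [Group G] {s : B → G} {u v : G}
    (h : BruhatLE s u v) : u = v ∨ genLength s u < genLength s v := by
  induction h with
  | refl => exact Or.inl rfl
  | tail _ h₂ ih =>
    obtain ⟨g, i, _, hlt⟩ := h₂
    rcases ih with rfl | h
    · exact Or.inr hlt
    · exact Or.inr (h.trans hlt)

end Generators

/-! ### The affine Weyl group of type `A_n^{(1)}` -/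

section AffineA

/-- The dual `𝔥*` of the Cartan subalgebra of `𝔰𝔩_{n+1}`, as the vectors of coordinate sum zero. -/
abbrev FinDual (n : ℕ) : Type :=
  LinearMap.ker (∑ i : Fin (n + 1), LinearMap.proj (R := ℂ) (φ := fun _ : Fin (n + 1) => ℂ) i)

/-- The dual of the Cartan subalgebra `𝔥 ⊕ ℂ c ⊕ ℂ d` of the affine Kac-Moody algebra of type
`A_n^{(1)}`: the triple `(v, c, d)` stands for `v + c Λ₀ + d δ`. -/
abbrev AffDual (n : ℕ) : Type := FinDual n × ℂ × ℂ

/-- The vector `e_i - e_j` (a root of `𝔰𝔩_{n+1}` if `i ≠ j`), with coordinates numbered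
from `0` to `n`. -/
def finRoot (n : ℕ) (i j : Fin (n + 1)) : FinDual n :=
  ⟨Pi.single i 1 - Pi.single j 1, by simp [LinearMap.mem_ker, LinearMap.sum_apply]⟩

/-- The simple affine roots: `α_i = ε_i - ε_{i+1}` for `1 ≤ i ≤ n` (where `ε_j` is the coordinate
vector numbered `j - 1`) and `α_0 = δ - θ`, where `θ = ε_1 - ε_{n+1}` is the highest root. -/
def simpleRoot (n : ℕ) (i : Fin (n + 1)) : AffDual n :=
  Fin.cases (-finRoot n 0 (Fin.last n), 0, 1)
    (fun j : Fin n => (finRoot n j.castSucc j.succ, 0, 0)) i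

/-- The linear form `(·, α)`, for the normalized symmetric bilinear form on `AffDual n`: the dot
product on `FinDual n`, `(Λ₀, δ) = 1`, `(Λ₀, Λ₀) = (δ, δ) = 0`, and `Λ₀`, `δ` orthogonal
to `FinDual n`. -/
def pairing (n : ℕ) (α : AffDual n) : Module.Dual ℂ (AffDual n) where
  toFun v := (∑ i, v.1.1 i * α.1.1 i) + v.2.1 * α.2.2 + v.2.2 * α.2.1
  map_add' v w := by
    simp only [Prod.fst_add, Prod.snd_add, Submodule.coe_add, Pi.add_apply, add_mul,
      Finset.sum_add_distrib]
    ring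
  map_smul' c v := by
    simp only [Prod.smul_fst, Prod.smul_snd, Submodule.coe_smul, Pi.smul_apply, smul_eq_mul,
      RingHom.id_apply, mul_assoc, mul_add, Finset.mul_sum]

theorem pairing_simpleRoot_self (n : ℕ) [NeZero n] (i : Fin (n + 1)) :
    pairing n (simpleRoot n i) (simpleRoot n i) = 2 := by
  have key : ∀ a b : Fin (n + 1), a ≠ b →
      (∑ i, (finRoot n a b).1 i * (finRoot n a b).1 i) = 2 := by
    intro a b hab
    have : ∀ i, (finRoot n a b).1 i * (finRoot n a b).1 i
        = Pi.single (M := fun _ => ℂ) a 1 i + Pi.single (M := fun _ => ℂ) b 1 i := by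
      intro i
      simp only [finRoot, Pi.sub_apply, Pi.single_apply]
      by_cases h1 : i = a <;> by_cases h2 : i = b <;> simp_all
    simp only [this, Finset.sum_add_distrib]
    simp
    norm_num
  refine Fin.cases ?_ (fun j => ?_) i
  · have h0 : (0 : Fin (n + 1)) ≠ Fin.last n := by
      intro h
      have := congrArg Fin.val h
      exact NeZero.ne n (by simpa using this.symm)
    have := key 0 (Fin.last n) h0
    simpa [pairing, simpleRoot] using this
  · have hj : j.castSucc ≠ j.succ := by
      intro h
      have := congrArg Fin.val h
      simp at this
    simpa [pairing, simpleRoot] using key _ _ hj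

/-- The simple reflection `s_i`, `v ↦ v - (v, α_i) α_i`, of `AffDual n`. -/
noncomputable def simpleReflection (n : ℕ) [NeZero n] (i : Fin (n + 1)) :
    AffDual n ≃ₗ[ℂ] AffDual n :=
  Module.reflection (pairing_simpleRoot_self n i)

theorem simpleReflection_apply (n : ℕ) [NeZero n] (i : Fin (n + 1)) (v : AffDual n) :
    simpleReflection n i v = v - pairing n (simpleRoot n i) v • simpleRoot n i :=
  Module.reflection_apply v (pairing_simpleRoot_self n i)

/-- The affine Weyl group of type `A_n^{(1)}`: the group generated by `s_0, …, s_n`. -/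
def AffineWeyl (n : ℕ) [NeZero n] : Type :=
  Subgroup.closure (Set.range (simpleReflection n))

noncomputable instance (n : ℕ) [NeZero n] : Group (AffineWeyl n) :=
  inferInstanceAs (Group (Subgroup.closure (Set.range (simpleReflection n))))

/-- The simple reflection `s_i` as an element of the affine Weyl group. -/
noncomputable def AffineWeyl.s (n : ℕ) [NeZero n] (i : Fin (n + 1)) : AffineWeyl n :=
  ⟨simpleReflection n i, Subgroup.subset_closure ⟨i, rfl⟩⟩

/-- The affine Weyl group is partially ordered by the Bruhat order. -/
noncomputable instance (n : ℕ) [NeZero n] : PartialOrder (AffineWeyl n) where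
  le := BruhatLE (AffineWeyl.s n)
  le_refl _ := Relation.ReflTransGen.refl
  le_trans _ _ _ := Relation.ReflTransGen.trans
  le_antisymm u v huv hvu := by
    rcases huv.eq_or_genLength_lt with h | h
    · exact h
    · rcases hvu.eq_or_genLength_lt with h' | h'
      · exact h'.symm
      · exact absurd h (lt_asymm h')

/-- The Weyl group of `𝔰𝔩_{n+1}`, as the subgroup generated by `s_1, …, s_n`. -/
noncomputable def finiteWeyl (n : ℕ) [NeZero n] : Subgroup (AffineWeyl n) :=
  Subgroup.closure (Set.range fun i : Fin n => AffineWeyl.s n i.succ)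

/-- `w` is a longest element of the finite Weyl group, for its length function with respect to
`s_1, …, s_n`. -/
def IsLongestElement (n : ℕ) [NeZero n] (w : AffineWeyl n) : Prop :=
  w ∈ finiteWeyl n ∧ ∀ v ∈ finiteWeyl n,
    genLength (fun i : Fin n => AffineWeyl.s n i.succ) v
      ≤ genLength (fun i : Fin n => AffineWeyl.s n i.succ) w

/-- The element `s_{i,j} = (s_1 s_2 ⋯ s_i) (s_n ⋯ s_{j+1} s_j)`, for `0 ≤ i < n` and
`1 ≤ j ≤ n + 1`. -/
noncomputable def sElem (n : ℕ) [NeZero n] (i j : ℕ) : AffineWeyl n :=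
  ((List.range' 1 i).map fun m => AffineWeyl.s n (Fin.ofNat (n + 1) m)).prod *
    ((List.range' j (n + 1 - j)).reverse.map fun m => AffineWeyl.s n (Fin.ofNat (n + 1) m)).prod

/-- The element `w_k = (s_0 s_{n-1,1})^k`. -/
noncomputable def wElem (n : ℕ) [NeZero n] (k : ℕ) : AffineWeyl n :=
  (AffineWeyl.s n 0 * sElem n (n - 1) 1) ^ k

end AffineA

/-! ### Existence of a longest element -/

section Longest

/-- The permutation `p` of the coordinates, fixing `Λ₀` and `δ`. -/
def permAct (n : ℕ) (p : Equiv.Perm (Fin (n + 1))) : AffDual n → AffDual n := fun v =>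
  (⟨fun i => v.1.1 (p i), by
    have h := v.1.2
    simp only [LinearMap.mem_ker, LinearMap.sum_apply, LinearMap.proj_apply] at h ⊢
    rw [← h]
    exact Equiv.sum_comp p v.1.1⟩, v.2)

theorem simpleReflection_succ_eq (n : ℕ) [NeZero n] (j : Fin n) (v : AffDual n) :
    simpleReflection n j.succ v = permAct n (Equiv.swap j.castSucc j.succ) v := by
  have hj : j.castSucc ≠ j.succ := by
    intro h
    have := congrArg Fin.val h
    simp at this
  rw [simpleReflection_apply]
  have hp : pairing n (simpleRoot n j.succ) v = v.1.1 j.castSucc - v.1.1 j.succ := by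
    simp [pairing, simpleRoot, finRoot, mul_sub, Finset.sum_sub_distrib, Pi.single_apply]
  rw [hp]
  refine Prod.ext (Subtype.ext (funext fun i => ?_)) ?_
  · simp only [simpleRoot, finRoot, permAct, Fin.cases_succ, Prod.fst_sub, Prod.smul_fst,
      Submodule.coe_sub, Submodule.coe_smul, Pi.sub_apply, Pi.smul_apply, smul_eq_mul,
      Pi.single_apply]
    by_cases h1 : i = j.castSucc
    · subst h1
      simp [hj]
    · by_cases h2 : i = j.succ
      · subst h2
        simp [hj.symm]
      · simp [h1, h2, Equiv.swap_apply_of_ne_of_ne h1 h2]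
  · simp [simpleRoot, permAct]

theorem finiteWeyl_finite (n : ℕ) [NeZero n] : (finiteWeyl n : Set (AffineWeyl n)).Finite := by
  have hmem : ∀ w ∈ finiteWeyl n, ∃ p, ⇑(w.1 : AffDual n ≃ₗ[ℂ] AffDual n) = permAct n p := by
    intro w hw
    induction hw using Subgroup.closure_induction with
    | mem x hx =>
      obtain ⟨j, rfl⟩ := hx
      exact ⟨_, funext fun v => simpleReflection_succ_eq n j v⟩
    | one => exact ⟨1, rfl⟩
    | mul x y _ _ hx hy =>
      obtain ⟨p, hp⟩ := hx
      obtain ⟨q, hq⟩ := hy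
      refine ⟨q * p, funext fun v => ?_⟩
      change x.1 (y.1 v) = _
      rw [hp, hq]
      rfl
    | inv x _ hx =>
      obtain ⟨p, hp⟩ := hx
      refine ⟨p⁻¹, funext fun v => ?_⟩
      change (x.1).symm v = _
      rw [LinearEquiv.symm_apply_eq, hp]
      refine Prod.ext (Subtype.ext (funext fun i => ?_)) rfl
      simp [permAct]
  refine Set.Finite.of_finite_image (f := fun w => (⇑(w.1 : AffDual n ≃ₗ[ℂ] AffDual n)))
    ((Set.finite_range (permAct n)).subset ?_) ?_
  · rintro _ ⟨w, hw, rfl⟩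
    obtain ⟨p, hp⟩ := hmem w hw
    exact ⟨p, hp.symm⟩
  · intro a _ b _ h
    exact Subtype.ext (DFunLike.coe_injective h)

theorem exists_isLongestElement (n : ℕ) [NeZero n] : ∃ w, IsLongestElement n w := by
  obtain ⟨w, hw, h⟩ := Set.exists_max_image (finiteWeyl n : Set (AffineWeyl n))
    (genLength fun i : Fin n => AffineWeyl.s n i.succ) (finiteWeyl_finite n) ⟨1, one_mem _⟩
  exact ⟨w, hw, h⟩

end Longest

/-!
The argument is uniform in `x ∈ finiteWeyl n`, applied to `x = 1` and to a longest element.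

The affine Weyl group acts on the real affine roots `ε_a - ε_b + m δ`, and each simple reflection
`s_i` negates its root and permutes the other positive roots. This formal property, recorded in
`PositiveSystem`, gives the strong exchange condition (`exists_word_mul_reflection`): for a positive
root `β` with reflection `t`, the element `u t` is longer or shorter than `u` according to the sign
of `u β`. The lifting property `bruhatLE_mul` of the Bruhat order follows: if `u ≤ v`, then
`u s_i ≤ v` or `u s_i ≤ v s_i`. Hence, if the length grows at each letter when `v` is multiplied by
the letters of a word with product `g` (`Ascends`), and `u ≤ v`, then `v ≤ v g`, and `u s_i ≤ v g`
for each letter `i` of the word.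

The product `s_{n-1,1}` is the reflection `s_θ` in the highest root, so that `s_0 s_θ` acts on the
roots as the translation `v ↦ v - (v, θ) δ` (`s_zero_mul_sElem_smul`). The roots that decide whether
the word `0, 1, …, n, …, 1` ascends from `x w_k` are the images under `x w_k` of roots `v` with
positive `δ`-coefficient and `(v, θ) < 0`. The translation only increases that coefficient, and the
finite Weyl group does not change it, so these images are positive and the word ascends
(`ascends_periodWord`). As the word contains every letter, a product of `k` simple reflections lies
below `x w_k`, by induction on `k`.
-/

/-! ### Words and length -/

section Words

variable {G B : Type*} [Group G] {s : B → G}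

theorem genLength_le_length (ω : List B) : genLength s (ω.map s).prod ≤ ω.length :=
  Nat.sInf_le ⟨ω, rfl, rfl⟩

theorem exists_word_length_eq_genLength {g : G} (hg : ∃ ω : List B, (ω.map s).prod = g) :
    ∃ ω : List B, ω.length = genLength s g ∧ (ω.map s).prod = g := by
  obtain ⟨ω, h⟩ := hg
  exact Nat.sInf_mem (s := {m | ∃ ω : List B, ω.length = m ∧ (ω.map s).prod = g}) ⟨_, ω, rfl, h⟩

end Words

/-! ### Positive systems and the Bruhat order -/

/-- A positive system for a group `G` generated by involutions `s i`, acting on an additive group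
`V`: a set `Pos` of positive roots and simple roots `root i`, such that `s i` negates `root i` and
permutes the other positive roots, and such that the reflection attached to a root depends on the
root only. The roots are the elements of `Pos` and their negatives. -/
structure PositiveSystem {G B : Type*} [Group G] (s : B → G) (V : Type*) [AddGroup V]
    [DistribMulAction G V] where
  Pos : V → Prop
  root : B → V
  pos_root : ∀ i, Pos (root i)
  not_pos_neg : ∀ v, Pos v → ¬ Pos (-v)
  smul_root : ∀ i, s i • root i = -root i
  pos_smul : ∀ i v, Pos v → v ≠ root i → Pos (s i • v)
  conj_eq : ∀ (w : G) i j, w • root i = root j → w * s i * w⁻¹ = s j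
  mul_self : ∀ i, s i * s i = 1
  exists_word : ∀ w : G, ∃ ω : List B, (ω.map s).prod = w

namespace PositiveSystem

variable {G B V : Type*} [Group G] {s : B → G} [AddGroup V] [DistribMulAction G V]
  (P : PositiveSystem s V)

/-- A root is a positive root or the negative of one. -/
def IsRoot (v : V) : Prop := P.Pos v ∨ P.Pos (-v)

theorem inv_s (P : PositiveSystem s V) (i : B) : (s i)⁻¹ = s i :=
  inv_eq_of_mul_eq_one_left (P.mul_self i)

theorem isRoot_s_smul (i : B) {v : V} (hv : P.IsRoot v) : P.IsRoot (s i • v) := by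
  rcases hv with h | h
  · by_cases hi : v = P.root i
    · right
      rw [hi, P.smul_root, neg_neg]
      exact P.pos_root i
    · exact Or.inl (P.pos_smul i v h hi)
  · by_cases hi : -v = P.root i
    · left
      rw [← neg_neg v, hi, smul_neg, P.smul_root, neg_neg]
      exact P.pos_root i
    · right
      rw [← smul_neg]
      exact P.pos_smul i _ h hi

theorem isRoot_smul (w : G) {v : V} (hv : P.IsRoot v) : P.IsRoot (w • v) := by
  obtain ⟨ω, rfl⟩ := P.exists_word w
  induction ω with
  | nil => simpa using hv
  | cons i ω ih =>
    rw [List.map_cons, List.prod_cons, mul_smul]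
    exact P.isRoot_s_smul i ih

theorem isRoot_root (i : B) : P.IsRoot (P.root i) := Or.inl (P.pos_root i)

/-- The strong exchange condition. If the positive root `g • root i` becomes negative under a word,
it passes through a simple root on the way, and multiplying by its reflection deletes that
letter. -/
theorem exists_word_mul_reflection (ω : List B) (g : G) (i : B) (hpos : P.Pos (g • P.root i))
    (hneg : P.Pos (-((ω.map s).prod • g • P.root i))) :
    ∃ ω' : List B, ω'.length + 1 = ω.length ∧
      (ω.map s).prod * (g * s i * g⁻¹) = (ω'.map s).prod := by
  induction ω with
  | nil => exact absurd (by simpa using hneg) (P.not_pos_neg _ hpos)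
  | cons j ω ih =>
    rw [List.map_cons, List.prod_cons] at hneg ⊢
    rcases P.isRoot_smul (ω.map s).prod (Or.inl hpos) with h | h
    · have hj : ((ω.map s).prod * g) • P.root i = P.root j := by
        by_contra hne
        rw [mul_smul] at hne hneg
        exact P.not_pos_neg _ (P.pos_smul j _ h hne) hneg
      refine ⟨ω, rfl, ?_⟩
      have hc := P.conj_eq _ _ _ hj
      rw [← hc]
      have h2 := P.mul_self i
      calc _ = (ω.map s).prod * g * (s i * s i) * g⁻¹ := by group
        _ = _ := by rw [h2]; group
    · obtain ⟨ω', hl, hp⟩ := ih h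
      exact ⟨j :: ω', by simp [hl], by rw [mul_assoc, hp]; simp⟩

theorem genLength_mul_reflection_lt {u g : G} {i : B} (hpos : P.Pos (g • P.root i))
    (hneg : P.Pos (-(u • g • P.root i))) :
    genLength s (u * (g * s i * g⁻¹)) < genLength s u := by
  obtain ⟨ω, hl, rfl⟩ := exists_word_length_eq_genLength (P.exists_word u)
  obtain ⟨ω', hl', hp⟩ := P.exists_word_mul_reflection ω g i hpos hneg
  rw [hp, ← hl]
  have := genLength_le_length (s := s) ω'
  omega

theorem genLength_lt_mul_reflection {u g : G} {i : B} (hpos : P.Pos (g • P.root i))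
    (hu : P.Pos (u • g • P.root i)) :
    genLength s u < genLength s (u * (g * s i * g⁻¹)) := by
  have h2 := P.mul_self i
  have h := P.genLength_mul_reflection_lt (u := u * (g * s i * g⁻¹)) hpos (by
    have : (u * (g * s i * g⁻¹)) • g • P.root i = -(u • g • P.root i) := by
      rw [← mul_smul, show u * (g * s i * g⁻¹) * g = u * g * s i by group, mul_smul, P.smul_root,
        smul_neg, mul_smul]
    rwa [this, neg_neg])
  have e : u * (g * s i * g⁻¹) * (g * s i * g⁻¹) = u := by
    calc _ = u * g * (s i * s i) * g⁻¹ := by group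
      _ = u := by rw [h2]; group
  rwa [e] at h

/-- Every reflection is attached to a positive root. -/
theorem exists_pos_conj (g : G) (i : B) :
    ∃ g' : G, g' * s i * g'⁻¹ = g * s i * g⁻¹ ∧ P.Pos (g' • P.root i) := by
  rcases P.isRoot_smul g (P.isRoot_root i) with h | h
  · exact ⟨g, rfl, h⟩
  · refine ⟨g * s i, by group, ?_⟩
    rw [mul_smul, P.smul_root, smul_neg]
    exact h

/-- Multiplying by a simple reflection on the right preserves a Bruhat step `u → v`, unless it
undoes the step: the positive root of the reflection stays positive unless it is the simple one. -/
theorem bruhatLE_mul_of_bruhatStep (P : PositiveSystem s V) {u v : G} (h : BruhatStep s u v)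
    (i : B) :
    BruhatLE s (u * s i) v ∨ BruhatLE s (u * s i) (v * s i) := by
  obtain ⟨g, j, hv, hlt⟩ := h
  obtain ⟨g, hg, hpos⟩ := P.exists_pos_conj g j
  rw [← hg] at hv
  have hu : P.Pos (u • g • P.root j) := by
    rcases P.isRoot_smul u (Or.inl hpos) with h | h
    · exact h
    · have := P.genLength_mul_reflection_lt hpos h
      rw [← hv] at this
      exact absurd hlt this.asymm
  by_cases hi : g • P.root j = P.root i
  · left
    rw [P.conj_eq g j i hi] at hv
    rw [hv]
    exact Relation.ReflTransGen.refl
  · right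
    have hpos' := P.pos_smul i _ hpos hi
    rw [← mul_smul] at hpos'
    have hlt' := P.genLength_lt_mul_reflection (u := u * s i) hpos' (by
      rw [mul_smul, mul_smul, ← mul_smul (s i) (s i), P.mul_self, one_smul]
      exact hu)
    have e : v * s i = u * s i * (s i * g * s j * (s i * g)⁻¹) := by
      have h2 := P.mul_self i
      calc v * s i = u * 1 * (g * s j * g⁻¹) * s i := by rw [hv]; group
        _ = u * (s i * s i) * (g * s j * g⁻¹) * (s i)⁻¹ := by rw [h2, P.inv_s]
        _ = _ := by group
    exact Relation.ReflTransGen.single ⟨s i * g, j, e, e ▸ hlt'⟩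

/-- The lifting property of the Bruhat order. -/
theorem bruhatLE_mul (P : PositiveSystem s V) {u v : G} (h : BruhatLE s u v) (i : B) :
    BruhatLE s (u * s i) v ∨ BruhatLE s (u * s i) (v * s i) := by
  induction h with
  | refl => exact Or.inr Relation.ReflTransGen.refl
  | tail _ h₂ ih =>
    rcases ih with h | h
    · exact Or.inl (h.tail h₂)
    · exact (P.bruhatLE_mul_of_bruhatStep h₂ i).imp h.trans h.trans

theorem bruhatStep_mul {v : G} {i : B} (h : P.Pos (v • P.root i)) :
    BruhatStep s v (v * s i) := by
  refine ⟨1, i, by simp, ?_⟩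
  simpa using P.genLength_lt_mul_reflection (u := v) (g := 1) (i := i)
    (by simpa using P.pos_root i) (by simpa using h)

/-- The word `ω` ascends from `v`: the length grows at each step when `v` is multiplied on the
right by the successive letters of `ω`. -/
def Ascends (v : G) : List B → Prop
  | [] => True
  | i :: ω => P.Pos (v • P.root i) ∧ Ascends (v * s i) ω

theorem ascends_append {v : G} {ω ω' : List B} (h : P.Ascends v ω)
    (h' : P.Ascends (v * (ω.map s).prod) ω') : P.Ascends v (ω ++ ω') := by
  induction ω generalizing v with
  | nil => simpa using h'
  | cons i ω ih =>
    refine ⟨h.1, ih h.2 ?_⟩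
    simpa [mul_assoc] using h'

theorem Ascends.bruhatLE {v : G} {ω : List B} (h : P.Ascends v ω) :
    BruhatLE s v (v * (ω.map s).prod) := by
  induction ω generalizing v with
  | nil =>
    rw [List.map_nil, List.prod_nil, mul_one]
    exact Relation.ReflTransGen.refl
  | cons i ω ih =>
    rw [List.map_cons, List.prod_cons, ← mul_assoc]
    exact (ih h.2).head (P.bruhatStep_mul h.1)

theorem Ascends.genLength_lt {v : G} {ω : List B} (h : P.Ascends v ω) (hω : ω ≠ []) :
    genLength s v < genLength s (v * (ω.map s).prod) := by
  cases ω with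
  | nil => exact absurd rfl hω
  | cons i ω =>
    obtain ⟨_, _, _, h1⟩ := P.bruhatStep_mul h.1
    rcases (Ascends.bruhatLE P h.2).eq_or_genLength_lt with h2 | h2
    · rw [List.map_cons, List.prod_cons, ← mul_assoc, ← h2]
      exact h1
    · rw [List.map_cons, List.prod_cons, ← mul_assoc]
      exact h1.trans h2

/-- A form of the subword property: an ascending word that contains the letter `i` absorbs a right
multiplication by `s i`. -/
theorem Ascends.bruhatLE_mul {u v : G} {ω : List B} (h : P.Ascends v ω) (huv : BruhatLE s u v)
    {i : B} (hi : i ∈ ω) : BruhatLE s (u * s i) (v * (ω.map s).prod) := by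
  induction ω generalizing v with
  | nil => simp at hi
  | cons j ω ih =>
    have hstep := P.bruhatStep_mul h.1
    rw [List.map_cons, List.prod_cons, ← mul_assoc]
    rcases List.mem_cons.1 hi with rfl | hi
    · refine Relation.ReflTransGen.trans ?_ (Ascends.bruhatLE P h.2)
      exact (P.bruhatLE_mul huv i).elim (fun h => h.tail hstep) id
    · exact ih h.2 (huv.tail hstep) hi

theorem one_bruhatLE (P : PositiveSystem s V) (w : G) : BruhatLE s 1 w := by
  induction hm : genLength s w using Nat.strong_induction_on generalizing w with
  | _ m ih =>
    obtain ⟨ω, hl, hw⟩ := exists_word_length_eq_genLength (P.exists_word w)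
    rcases List.eq_nil_or_concat' ω with rfl | ⟨ω', i, rfl⟩
    · rw [← hw]
      exact Relation.ReflTransGen.refl
    · have e : w = (ω'.map s).prod * s i := by simp [← hw]
      have h1 : genLength s (ω'.map s).prod < genLength s w := by
        have := genLength_le_length (s := s) ω'
        rw [List.length_append, List.length_singleton] at hl
        omega
      exact (ih _ (hm ▸ h1) _ rfl).tail ⟨1, i, by simpa using e, h1⟩

/-- If a word containing every letter ascends from every term of the sequence `x * g ^ k`, where `g`
is its product, then every element is below some term: a word of length `k` is a subword of the
`k`-th power. -/
theorem exists_bruhatLE_mul_pow {x : G} {ω : List B} (hω : ∀ i, i ∈ ω)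
    (h : ∀ k, P.Ascends (x * (ω.map s).prod ^ k) ω) (a : G) :
    ∃ k, BruhatLE s a (x * (ω.map s).prod ^ k) := by
  obtain ⟨τ, rfl⟩ := P.exists_word a
  refine ⟨τ.length, ?_⟩
  induction τ using List.reverseRecOn with
  | nil => exact P.one_bruhatLE _
  | append_singleton τ i ih =>
    have := Ascends.bruhatLE_mul P (h _) ih (hω i)
    simpa [pow_succ, mul_assoc] using this

end PositiveSystem

/-! ### The affine Weyl group acting on the affine roots -/

section AffineRoots

variable (n : ℕ)

theorem pairing_comm (v w : AffDual n) : pairing n v w = pairing n w v := by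
  simp only [pairing, LinearMap.coe_mk, AddHom.coe_mk, mul_comm]
  ring

theorem pairing_sub_left (u v w : AffDual n) :
    pairing n (u - v) w = pairing n u w - pairing n v w := by
  rw [pairing_comm, map_sub, pairing_comm n w u, pairing_comm n w v]

theorem pairing_smul_left (c : ℂ) (v w : AffDual n) :
    pairing n (c • v) w = c * pairing n v w := by
  rw [pairing_comm, map_smul, pairing_comm n w v, smul_eq_mul]

/-- The vector `ε_a - ε_b + m δ`, with coordinates numbered from `0` to `n`. -/
def affRoot (a b : Fin (n + 1)) (m : ℤ) : AffDual n := (finRoot n a b, 0, m)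

/-- The positive real affine roots: `ε_a - ε_b + m δ` with `a ≠ b`, and either `m > 0`, or `m = 0`
and `a < b`. -/
def IsPosAffRoot (v : AffDual n) : Prop :=
  ∃ a b : Fin (n + 1), ∃ m : ℤ, a ≠ b ∧ (0 < m ∨ m = 0 ∧ a < b) ∧ v = affRoot n a b m

variable {n}

theorem neg_affRoot (a b : Fin (n + 1)) (m : ℤ) : -affRoot n a b m = affRoot n b a (-m) := by
  refine Prod.ext (Subtype.ext ?_) (Prod.ext ?_ ?_) <;> simp [affRoot, finRoot]

theorem affRoot_inj {a b c d : Fin (n + 1)} {m k : ℤ} (hab : a ≠ b)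
    (h : affRoot n a b m = affRoot n c d k) : a = c ∧ b = d ∧ m = k := by
  have h1 : ∀ i, (finRoot n a b).1 i = (finRoot n c d).1 i := fun i => by
    rw [show finRoot n a b = finRoot n c d from congrArg Prod.fst h]
  have h2 : (m : ℂ) = k := congrArg (fun v => v.2.2) h
  have ha := h1 a
  have hb := h1 b
  simp only [finRoot, Pi.sub_apply, Pi.single_apply, if_true, if_neg hab, if_neg hab.symm] at ha hb
  refine ⟨?_, ?_, by exact_mod_cast h2⟩
  · by_contra hne
    rw [if_neg hne] at ha
    split_ifs at ha <;> norm_num at ha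
  · by_contra hne
    rw [if_neg hne] at hb
    split_ifs at hb <;> norm_num at hb

theorem finRoot_permute (σ : Equiv.Perm (Fin (n + 1))) (hσ : ∀ i, σ (σ i) = i)
    (a b i : Fin (n + 1)) : (finRoot n a b).1 (σ i) = (finRoot n (σ a) (σ b)).1 i := by
  have h : ∀ c, σ i = c ↔ i = σ c := fun c =>
    ⟨fun h => by rw [← h, hσ], fun h => by rw [h, hσ]⟩
  simp [finRoot, Pi.single_apply, h]

theorem simpleRoot_zero : simpleRoot n 0 = affRoot n (Fin.last n) 0 1 := by
  refine Prod.ext (Subtype.ext ?_) (Prod.ext ?_ ?_) <;> simp [affRoot, finRoot, simpleRoot]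

theorem simpleRoot_succ (j : Fin n) : simpleRoot n j.succ = affRoot n j.castSucc j.succ 0 := by
  refine Prod.ext rfl (Prod.ext ?_ ?_) <;> simp [affRoot, simpleRoot]

theorem pairing_affRoot_zero_last (v : AffDual n) :
    pairing n (affRoot n 0 (Fin.last n) 0) v = v.1.1 0 - v.1.1 (Fin.last n) := by
  simp [pairing, affRoot, finRoot, mul_sub, Finset.sum_sub_distrib, Pi.single_apply]

theorem pairing_simpleRoot_zero (v : AffDual n) :
    pairing n (simpleRoot n 0) v = v.1.1 (Fin.last n) - v.1.1 0 + v.2.1 := by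
  simp [simpleRoot_zero, pairing, affRoot, finRoot, mul_sub, Finset.sum_sub_distrib,
    Pi.single_apply]

theorem not_isPosAffRoot_neg (v : AffDual n) (hv : IsPosAffRoot n v) :
    ¬ IsPosAffRoot n (-v) := by
  rintro ⟨c, d, k, -, h', h⟩
  obtain ⟨a, b, m, hab, h'', rfl⟩ := hv
  rw [neg_affRoot] at h
  obtain ⟨rfl, rfl, rfl⟩ := affRoot_inj hab.symm h
  rcases h' with h1 | ⟨h1, h2⟩ <;> rcases h'' with h3 | ⟨h3, h4⟩
  · omega
  · omega
  · omega
  · exact absurd h2 h4.asymm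

variable [NeZero n]

theorem zero_ne_last : (0 : Fin (n + 1)) ≠ Fin.last n := by
  intro h
  exact NeZero.ne n (by simpa using (congrArg Fin.val h).symm)

noncomputable instance : DistribMulAction (AffineWeyl n) (AffDual n) :=
  inferInstanceAs
    (DistribMulAction (Subgroup.closure (Set.range (simpleReflection n))) (AffDual n))

theorem s_smul (i : Fin (n + 1)) (v : AffDual n) :
    AffineWeyl.s n i • v = v - pairing n (simpleRoot n i) v • simpleRoot n i :=
  simpleReflection_apply n i v

theorem smul_smul_complex (w : AffineWeyl n) (c : ℂ) (v : AffDual n) : w • c • v = c • w • v :=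
  map_smul w.1 c v

theorem affineWeyl_ext {w w' : AffineWeyl n} (h : ∀ v : AffDual n, w • v = w' • v) : w = w' :=
  Subtype.ext (LinearEquiv.ext h)

theorem s_mul_self (i : Fin (n + 1)) : AffineWeyl.s n i * AffineWeyl.s n i = 1 := by
  refine affineWeyl_ext fun v => ?_
  rw [mul_smul, one_smul]
  exact Module.involutive_reflection (pairing_simpleRoot_self n i) v

theorem exists_word_affineWeyl (w : AffineWeyl n) :
    ∃ ω : List (Fin (n + 1)), (ω.map (AffineWeyl.s n)).prod = w := by
  obtain ⟨w, hw⟩ := w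
  have hinv : ∀ i, (simpleReflection n i)⁻¹ = simpleReflection n i := fun i =>
    inv_eq_of_mul_eq_one_left (congrArg Subtype.val (s_mul_self i))
  suffices ∃ ω : List (Fin (n + 1)), (ω.map (simpleReflection n)).prod = w by
    obtain ⟨ω, rfl⟩ := this
    refine ⟨ω, Subtype.ext ?_⟩
    change ((ω.map (AffineWeyl.s n)).prod).1 = (ω.map (simpleReflection n)).prod
    clear hw
    induction ω with
    | nil => rfl
    | cons i ω ih =>
      rw [List.map_cons, List.prod_cons, List.map_cons, List.prod_cons, ← ih]
      rfl
  induction hw using Subgroup.closure_induction with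
  | mem x hx =>
    obtain ⟨i, rfl⟩ := hx
    exact ⟨[i], by simp⟩
  | one => exact ⟨[], rfl⟩
  | mul x y _ _ hx hy =>
    obtain ⟨ω, rfl⟩ := hx
    obtain ⟨τ, rfl⟩ := hy
    exact ⟨ω ++ τ, by simp⟩
  | inv x _ hx =>
    obtain ⟨ω, rfl⟩ := hx
    refine ⟨ω.reverse, ?_⟩
    simp only [List.prod_inv_reverse, List.map_map, List.map_reverse]
    congr 2

theorem pairing_smul_smul (w : AffineWeyl n) (u v : AffDual n) :
    pairing n (w • u) (w • v) = pairing n u v := by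
  obtain ⟨ω, rfl⟩ := exists_word_affineWeyl w
  induction ω with
  | nil => simp
  | cons i ω ih =>
    rw [List.map_cons, List.prod_cons, mul_smul, mul_smul, s_smul, s_smul, ← ih]
    simp only [pairing_sub_left, pairing_smul_left, map_sub, map_smul, smul_eq_mul,
      pairing_simpleRoot_self]
    rw [pairing_comm n ((ω.map (AffineWeyl.s n)).prod • u) (simpleRoot n i)]
    ring

/-- The conjugate by `w` of a simple reflection is the reflection in the image of its root. -/
theorem conj_s_smul (w : AffineWeyl n) (i : Fin (n + 1)) (v : AffDual n) :
    (w * AffineWeyl.s n i * w⁻¹) • v =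
      v - pairing n (w • simpleRoot n i) v • w • simpleRoot n i := by
  rw [mul_smul, mul_smul, s_smul, smul_sub, smul_inv_smul, smul_smul_complex,
    ← pairing_smul_smul w, smul_inv_smul]

theorem s_succ_smul_affRoot (j : Fin n) (a b : Fin (n + 1)) (m : ℤ) :
    AffineWeyl.s n j.succ • affRoot n a b m =
      affRoot n (Equiv.swap j.castSucc j.succ a) (Equiv.swap j.castSucc j.succ b) m := by
  refine (simpleReflection_succ_eq n j _).trans ?_
  exact Prod.ext (Subtype.ext (funext fun i =>
    finRoot_permute _ (Equiv.swap_apply_self _ _) a b i)) rfl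

theorem s_zero_smul_affRoot (a b : Fin (n + 1)) (m : ℤ) :
    AffineWeyl.s n 0 • affRoot n a b m =
      affRoot n (Equiv.swap 0 (Fin.last n) a) (Equiv.swap 0 (Fin.last n) b)
        (m + ((if a = 0 then 1 else 0) - (if a = Fin.last n then 1 else 0)
          - (if b = 0 then 1 else 0) + (if b = Fin.last n then 1 else 0))) := by
  have h0 := zero_ne_last (n := n)
  rw [s_smul, pairing_simpleRoot_zero, simpleRoot_zero]
  refine Prod.ext (Subtype.ext (funext fun i => ?_)) (Prod.ext ?_ ?_)
  · simp only [affRoot]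
    rw [← finRoot_permute _ (Equiv.swap_apply_self _ _)]
    simp only [finRoot, Prod.fst_sub, Prod.smul_fst, Submodule.coe_sub, Submodule.coe_smul,
      Pi.sub_apply, Pi.smul_apply, smul_eq_mul]
    by_cases h1 : i = 0
    · subst h1
      simp [h0]
    · by_cases h2 : i = Fin.last n
      · subst h2
        simp [h0.symm]
      · simp [h1, h2, Equiv.swap_apply_of_ne_of_ne h1 h2]
  · simp [affRoot]
  · simp only [affRoot, finRoot, Prod.snd_sub, Prod.smul_snd, Pi.sub_apply, Pi.single_apply,
      smul_eq_mul]
    push_cast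
    simp only [eq_comm]
    ring

theorem isPosAffRoot_simpleRoot (i : Fin (n + 1)) : IsPosAffRoot n (simpleRoot n i) := by
  refine Fin.cases ?_ (fun j => ?_) i
  · exact ⟨_, _, _, zero_ne_last.symm, Or.inl one_pos, simpleRoot_zero⟩
  · have hj : j.castSucc < j.succ := Fin.castSucc_lt_succ
    exact ⟨_, _, _, hj.ne, Or.inr ⟨rfl, hj⟩, simpleRoot_succ j⟩

theorem s_smul_isPosAffRoot (i : Fin (n + 1)) (v : AffDual n) (hv : IsPosAffRoot n v)
    (hi : v ≠ simpleRoot n i) : IsPosAffRoot n (AffineWeyl.s n i • v) := by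
  obtain ⟨a, b, m, hab, hm, rfl⟩ := hv
  revert hi
  refine Fin.cases (fun hi => ?_) (fun j hi => ?_) i
  · rw [simpleRoot_zero] at hi
    rw [s_zero_smul_affRoot]
    refine ⟨_, _, _, fun h => hab (Equiv.injective _ h), ?_, rfl⟩
    have h0 := zero_ne_last (n := n)
    have hlast : ∀ c : Fin (n + 1), c ≠ Fin.last n → c < Fin.last n := fun c hc =>
      lt_of_le_of_ne (Fin.le_last c) hc
    have hzero : ∀ c : Fin (n + 1), c ≠ 0 → 0 < c := fun c hc => Fin.pos_of_ne_zero hc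
    by_cases ha0 : a = 0
    · subst ha0
      have hb0 : b ≠ 0 := hab.symm
      left
      by_cases hb : b = Fin.last n <;> simp [h0, hb0, hb, h0.symm] <;> omega
    · by_cases ha : a = Fin.last n
      · subst ha
        have hm1 : 0 < m := by
          rcases hm with h | ⟨_, h⟩
          · exact h
          · exact absurd h (Fin.le_last b).not_gt
        by_cases hb0 : b = 0
        · subst hb0
          have : m ≠ 1 := by
            rintro rfl
            exact hi rfl
          simp [h0, h0.symm, hzero _ h0.symm]
          omega
        · have hb : b ≠ Fin.last n := hab.symm
          have := hzero b hb0
          simp [h0.symm, hb0, hb, Equiv.swap_apply_of_ne_of_ne hb0 hb, this]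
          omega
      · by_cases hb0 : b = 0
        · subst hb0
          have hm1 : 0 < m := by
            rcases hm with h | ⟨_, h⟩
            · exact h
            · exact absurd h (Fin.zero_le a).not_gt
          have := hlast a ha
          simp [ha0, ha, h0, Equiv.swap_apply_of_ne_of_ne ha0 ha, this]
          omega
        · by_cases hb : b = Fin.last n
          · subst hb
            left
            simp [ha0, ha, h0.symm]
            omega
          · simpa [ha0, ha, hb0, hb, Equiv.swap_apply_of_ne_of_ne ha0 ha,
              Equiv.swap_apply_of_ne_of_ne hb0 hb] using hm
  · rw [simpleRoot_succ] at hi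
    rw [s_succ_smul_affRoot]
    refine ⟨_, _, _, fun h => hab (Equiv.injective _ h), ?_, rfl⟩
    rcases hm with hm | ⟨rfl, hlt⟩
    · exact Or.inl hm
    · refine Or.inr ⟨rfl, ?_⟩
      have hne : ¬ (a = j.castSucc ∧ b = j.succ) := by
        rintro ⟨rfl, rfl⟩
        exact hi rfl
      simp only [Equiv.swap_apply_def, Fin.lt_def, Fin.ext_iff, Fin.val_castSucc,
        Fin.val_succ] at hlt hne ⊢
      split_ifs <;> simp <;> omega

variable (n) in
/-- The real roots of type `A_n^{(1)}` form a positive system for the affine Weyl group. -/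
noncomputable def affinePositiveSystem : PositiveSystem (AffineWeyl.s n) (AffDual n) where
  Pos := IsPosAffRoot n
  root := simpleRoot n
  pos_root := isPosAffRoot_simpleRoot
  not_pos_neg := not_isPosAffRoot_neg
  smul_root i := by
    rw [s_smul, pairing_simpleRoot_self, two_smul]
    abel
  pos_smul := s_smul_isPosAffRoot
  conj_eq w i j h := affineWeyl_ext fun v => by rw [conj_s_smul, h, s_smul]
  mul_self := s_mul_self
  exists_word := exists_word_affineWeyl

end AffineRoots

/-! ### The translation `s_0 s_θ` -/

section Translation

variable (n : ℕ)

/-- The highest root `θ = ε_1 - ε_{n+1}` of the finite root system. -/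
def highestRoot : AffDual n := affRoot n 0 (Fin.last n) 0

/-- The word `1, 2, …, j`. -/
def upWord (j : ℕ) : List (Fin (n + 1)) := (List.range' 1 j).map (Fin.ofNat (n + 1))

/-- The word `0, 1, …, n - 1, n, n - 1, …, 1`, an expression of `s_0 s_θ`. -/
def periodWord : List (Fin (n + 1)) := 0 :: (upWord n n ++ (upWord n (n - 1)).reverse)

variable {n}

theorem pairing_highestRoot (v : AffDual n) :
    pairing n (highestRoot n) v = v.1.1 0 - v.1.1 (Fin.last n) := pairing_affRoot_zero_last v

theorem simpleRoot_zero_eq : simpleRoot n 0 = (0, 0, 1) - highestRoot n := by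
  rw [simpleRoot_zero]
  refine Prod.ext (Subtype.ext ?_) (Prod.ext ?_ ?_) <;> simp [highestRoot, affRoot, finRoot]

theorem upWord_succ (j : ℕ) : upWord n (j + 1) = upWord n j ++ [Fin.ofNat (n + 1) (j + 1)] := by
  simp [upWord, List.range'_1_concat, add_comm]

theorem ofNat_add_one {j : ℕ} (hj : j < n) :
    Fin.ofNat (n + 1) (j + 1) = (⟨j, hj⟩ : Fin n).succ := by
  ext
  simp [Nat.mod_eq_of_lt, hj]

variable [NeZero n]

theorem isRoot_affRoot {a b : Fin (n + 1)} (hab : a ≠ b) (m : ℤ) :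
    (affinePositiveSystem n).IsRoot (affRoot n a b m) := by
  by_cases h : 0 < m ∨ m = 0 ∧ a < b
  · exact Or.inl ⟨a, b, m, hab, h, rfl⟩
  · refine Or.inr ⟨b, a, -m, hab.symm, ?_, neg_affRoot a b m⟩
    push Not at h
    rcases h.1.lt_or_eq with h1 | h1
    · exact Or.inl (by omega)
    · exact Or.inr ⟨by omega, lt_of_le_of_ne (h.2 h1) hab.symm⟩

theorem pos_of_isRoot {v : AffDual n} (hv : (affinePositiveSystem n).IsRoot v) {m : ℤ}
    (hm : 1 ≤ m) (h : v.2.2 = m) : (affinePositiveSystem n).Pos v := by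
  rcases hv with hv | ⟨a, b, k, _, hk, e⟩
  · exact hv
  · have h1 : -v.2.2 = (k : ℂ) := congrArg (fun v => v.2.2) e
    rw [h] at h1
    have h2 : -m = k := by exact_mod_cast h1
    omega

theorem finiteWeyl_smul_snd {x : AffineWeyl n} (hx : x ∈ finiteWeyl n) (v : AffDual n) :
    (x • v).2 = v.2 := by
  induction hx using Subgroup.closure_induction generalizing v with
  | mem x hx =>
    obtain ⟨j, rfl⟩ := hx
    change (simpleReflection n j.succ v).2 = v.2
    rw [simpleReflection_succ_eq]
    rfl
  | one => rw [one_smul]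
  | mul x y _ _ hx hy => rw [mul_smul, hx, hy]
  | inv x _ hx => rw [← hx, smul_inv_smul]

theorem pairing_highestRoot_self : pairing n (highestRoot n) (highestRoot n) = 2 := by
  have h0 := zero_ne_last (n := n)
  rw [pairing_highestRoot]
  simp [highestRoot, affRoot, finRoot, h0]
  norm_num

theorem s_zero_smul {v : AffDual n} (hv : v.2.1 = 0) :
    AffineWeyl.s n 0 • v =
      v + pairing n (highestRoot n) v • ((0, 0, 1) - highestRoot n : AffDual n) := by
  rw [s_smul, pairing_simpleRoot_zero, ← simpleRoot_zero_eq, hv, pairing_highestRoot, add_zero]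
  module

/-- The product `s_1 s_2 ⋯ s_j` moves the coordinate numbered `j` to `0`, and fixes the later
ones. -/
theorem upWord_smul_affRoot (j : ℕ) (a b : Fin (n + 1)) (ha : a.val = j) (hab : a < b) (m : ℤ) :
    ((upWord n j).map (AffineWeyl.s n)).prod • affRoot n a b m = affRoot n 0 b m := by
  induction j generalizing a with
  | zero =>
    obtain rfl : a = 0 := Fin.ext ha
    simp [upWord]
  | succ j ih =>
    have hj : j < n := by omega
    obtain rfl : a = (⟨j, hj⟩ : Fin n).succ := Fin.ext ha
    rw [upWord_succ, List.map_append, List.prod_append, mul_smul, ofNat_add_one hj]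
    have hb : b ≠ (⟨j, hj⟩ : Fin n).castSucc := by
      rintro rfl
      simp [Fin.lt_def] at hab
    simp only [List.map_cons, List.map_nil, List.prod_singleton, s_succ_smul_affRoot,
      Equiv.swap_apply_right]
    rw [Equiv.swap_apply_of_ne_of_ne hb hab.ne']
    refine ih _ rfl ?_
    simp only [Fin.lt_def, Fin.val_succ, Fin.val_castSucc] at hab ⊢
    omega

theorem upWord_smul_simpleRoot {j : ℕ} (hj : j < n) :
    ((upWord n j).map (AffineWeyl.s n)).prod • simpleRoot n (Fin.ofNat (n + 1) (j + 1)) =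
      affRoot n 0 (Fin.ofNat (n + 1) (j + 1)) 0 := by
  rw [ofNat_add_one hj, simpleRoot_succ]
  exact upWord_smul_affRoot (n := n) j _ _ rfl Fin.castSucc_lt_succ _

theorem prod_reverse_map_s (ω : List (Fin (n + 1))) :
    (ω.reverse.map (AffineWeyl.s n)).prod = (ω.map (AffineWeyl.s n)).prod⁻¹ := by
  have hinv : ∀ i, (AffineWeyl.s n i)⁻¹ = AffineWeyl.s n i :=
    PositiveSystem.inv_s (affinePositiveSystem n)
  simp [List.prod_inv_reverse, Function.comp_def, hinv]

theorem upWord_self : upWord n n = upWord n (n - 1) ++ [Fin.last n] := by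
  obtain ⟨m, rfl⟩ := Nat.exists_eq_succ_of_ne_zero (NeZero.ne n)
  rw [upWord_succ, Nat.succ_sub_one]
  congr 2
  ext
  simp

theorem sElem_eq :
    sElem n (n - 1) 1 = ((upWord n n ++ (upWord n (n - 1)).reverse).map (AffineWeyl.s n)).prod := by
  have h : (upWord n n ++ (upWord n (n - 1)).reverse) =
      upWord n (n - 1) ++ (upWord n n).reverse := by
    simp [upWord_self (n := n)]
  rw [h, List.map_append, List.prod_append]
  simp [sElem, upWord, Function.comp_def]

theorem sElem_eq_conj :
    sElem n (n - 1) 1 = ((upWord n (n - 1)).map (AffineWeyl.s n)).prod * AffineWeyl.s n (Fin.last n)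
      * ((upWord n (n - 1)).map (AffineWeyl.s n)).prod⁻¹ := by
  rw [sElem_eq, List.map_append, List.prod_append, prod_reverse_map_s, upWord_self]
  simp

/-- `s_{n-1,1}` is the reflection in the highest root. -/
theorem sElem_smul (v : AffDual n) :
    sElem n (n - 1) 1 • v = v - pairing n (highestRoot n) v • highestRoot n := by
  have h : ((upWord n (n - 1)).map (AffineWeyl.s n)).prod • simpleRoot n (Fin.last n) =
      highestRoot n := by
    have hn : n - 1 < n := Nat.sub_lt (Nat.pos_of_ne_zero (NeZero.ne n)) one_pos
    have e : Fin.ofNat (n + 1) (n - 1 + 1) = Fin.last n := by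
      ext
      simp [Nat.sub_add_cancel (Nat.one_le_iff_ne_zero.2 (NeZero.ne n))]
    have := upWord_smul_simpleRoot hn
    rwa [e] at this
  rw [sElem_eq_conj, conj_s_smul, h]

theorem prod_periodWord :
    ((periodWord n).map (AffineWeyl.s n)).prod = AffineWeyl.s n 0 * sElem n (n - 1) 1 := by
  rw [periodWord, List.map_cons, List.prod_cons, sElem_eq]

/-- On level zero, `s_0 s_θ` is the translation `v ↦ v - (v, θ) δ`. -/
theorem s_zero_mul_sElem_smul {v : AffDual n} (hv : v.2.1 = 0) :
    (AffineWeyl.s n 0 * sElem n (n - 1) 1) • v =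
      v - pairing n (highestRoot n) v • ((0, 0, 1) : AffDual n) := by
  rw [mul_smul, sElem_smul, s_zero_smul (by simp [hv, highestRoot, affRoot]), map_sub, map_smul,
    pairing_highestRoot_self, smul_eq_mul]
  module

/-- The affine roots `v` with positive `δ`-coefficient and `(v, θ)` a nonpositive integer. They are
preserved by `s_0 s_θ` and become positive roots under the finite Weyl group. -/
def IsStable (v : AffDual n) : Prop :=
  (affinePositiveSystem n).IsRoot v ∧ v.2.1 = 0 ∧
    ∃ (m : ℤ) (c : ℕ), 1 ≤ m ∧ v.2.2 = m ∧ pairing n (highestRoot n) v = -c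

theorem IsStable.smul {v : AffDual n} (h : IsStable v) :
    IsStable ((AffineWeyl.s n 0 * sElem n (n - 1) 1) • v) := by
  obtain ⟨hr, hv, m, c, hm, hvm, hc⟩ := h
  refine ⟨PositiveSystem.isRoot_smul _ _ hr, ?_, m + c, c, by omega, ?_, ?_⟩
  · rw [s_zero_mul_sElem_smul hv]
    simp [hv]
  · rw [s_zero_mul_sElem_smul hv, hc]
    simp [hvm]
  · rw [s_zero_mul_sElem_smul hv, map_sub, map_smul, pairing_highestRoot (0, 0, 1), hc]
    simp

theorem IsStable.pos {v : AffDual n} (h : IsStable v) {x : AffineWeyl n} (hx : x ∈ finiteWeyl n)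
    (k : ℕ) : (affinePositiveSystem n).Pos ((x * wElem n k) • v) := by
  have hk : IsStable (wElem n k • v) := by
    induction k with
    | zero => simpa [wElem] using h
    | succ k ih =>
      rw [wElem, pow_succ', mul_smul]
      exact ih.smul
  obtain ⟨hr, -, m, -, hm, hvm, -⟩ := hk
  rw [mul_smul]
  refine pos_of_isRoot (PositiveSystem.isRoot_smul _ _ hr) hm ?_
  rw [finiteWeyl_smul_snd hx, hvm]

theorem isStable_simpleRoot_zero : IsStable (simpleRoot n 0) := by
  refine ⟨PositiveSystem.isRoot_root _ 0, ?_, 1, 2, le_rfl, ?_, ?_⟩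
  · simp [simpleRoot_zero, affRoot]
  · simp [simpleRoot_zero, affRoot]
  · rw [simpleRoot_zero_eq, map_sub, pairing_highestRoot_self, pairing_highestRoot]
    simp

/-- The roots `ε_a - ε_b` that pair positively with `θ` become stable under `s_0`: for `q = (v, θ)`,
`s_0 v` has `δ`-coefficient `q` and pairs to `-q` with `θ`. -/
theorem isStable_s_zero_smul {a b : Fin (n + 1)} (hab : a ≠ b) (h : a = 0 ∨ b = Fin.last n) :
    IsStable (AffineWeyl.s n 0 • affRoot n a b 0) := by
  have h0 := zero_ne_last (n := n)
  obtain ⟨c, hc, e⟩ : ∃ c : ℕ, 1 ≤ c ∧ pairing n (highestRoot n) (affRoot n a b 0) = c := by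
    rw [pairing_highestRoot]
    simp only [affRoot, finRoot, Pi.sub_apply, Pi.single_apply]
    rcases h with rfl | rfl
    · by_cases hb : b = Fin.last n
      · exact ⟨2, by simp, by simp [hb, h0, h0.symm]; norm_num⟩
      · exact ⟨1, le_rfl, by simp [hab, Ne.symm hb, h0.symm]⟩
    · by_cases ha : a = 0
      · exact ⟨2, by simp, by simp [ha, h0, h0.symm]; norm_num⟩
      · exact ⟨1, le_rfl, by simp [Ne.symm ha, hab.symm, h0]⟩
  have hv : (affRoot n a b 0).2.1 = 0 := rfl
  refine ⟨PositiveSystem.isRoot_smul _ _ (isRoot_affRoot hab 0), ?_, c, c, by omega, ?_, ?_⟩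
  · rw [s_zero_smul hv]
    simp [affRoot, highestRoot]
  · rw [s_zero_smul hv, e]
    simp [affRoot, highestRoot]
  · rw [s_zero_smul hv, map_add, map_smul, map_sub, pairing_highestRoot_self, e,
      pairing_highestRoot]
    simp
    ring

end Translation

/-! ### Ascending words and cofinality -/

section Cofinal

variable {n : ℕ}

theorem mem_periodWord (i : Fin (n + 1)) : i ∈ periodWord n := by
  refine Fin.cases (by simp [periodWord]) (fun j => ?_) i
  refine List.mem_cons_of_mem _ (List.mem_append_left _ (List.mem_map.2 ⟨j + 1, ?_, ?_⟩))
  · rw [List.mem_range'_1]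
    omega
  · exact ofNat_add_one j.2

variable [NeZero n]

/-- The roots met along the word `1, …, j` are `ε_1 - ε_2, …, ε_1 - ε_{j+1}`. -/
theorem ascends_upWord {z : AffineWeyl n}
    (hz : ∀ b, 0 ≠ b → (affinePositiveSystem n).Pos (z • affRoot n 0 b 0)) (j : ℕ) (hj : j ≤ n) :
    (affinePositiveSystem n).Ascends z (upWord n j) := by
  induction j with
  | zero => trivial
  | succ j ih =>
    rw [upWord_succ]
    refine PositiveSystem.ascends_append _ (ih (by omega)) ⟨?_, trivial⟩
    rw [mul_smul]
    change IsPosAffRoot n (z • ((upWord n j).map (AffineWeyl.s n)).prod •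
      simpleRoot n (Fin.ofNat (n + 1) (j + 1)))
    rw [upWord_smul_simpleRoot hj, ofNat_add_one hj]
    exact hz _ (Fin.succ_ne_zero _).symm

/-- The roots met along the word `j, …, 1`, read after `s_θ s_1 ⋯ s_j`, are
`ε_{j+1} - ε_{n+1}, …, ε_2 - ε_{n+1}`. -/
theorem ascends_reverse_upWord {z : AffineWeyl n}
    (hz : ∀ a, a ≠ Fin.last n → (affinePositiveSystem n).Pos (z • affRoot n a (Fin.last n) 0))
    (j : ℕ) (hj : j < n) :
    (affinePositiveSystem n).Ascends
      (z * sElem n (n - 1) 1 * ((upWord n j).map (AffineWeyl.s n)).prod) (upWord n j).reverse := by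
  induction j with
  | zero => trivial
  | succ j ih =>
    have hj' : j < n := by omega
    have h2 := s_mul_self (n := n) (Fin.ofNat (n + 1) (j + 1))
    have hlast : Fin.ofNat (n + 1) (j + 1) ≠ Fin.last n := by
      rw [ofNat_add_one hj']
      intro h
      have := congrArg Fin.val h
      simp at this
      omega
    rw [upWord_succ, List.reverse_append, List.map_append, List.prod_append]
    simp only [List.reverse_singleton, List.singleton_append, List.map_cons, List.map_nil,
      List.prod_singleton]
    refine ⟨?_, ?_⟩
    · -- The next root is `-s_θ (ε_1 - ε_{j+2}) = ε_{j+2} - ε_{n+1}`.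
      have e : (z * sElem n (n - 1) 1 * (((upWord n j).map (AffineWeyl.s n)).prod *
          AffineWeyl.s n (Fin.ofNat (n + 1) (j + 1)))) • simpleRoot n (Fin.ofNat (n + 1) (j + 1)) =
          z • affRoot n (Fin.ofNat (n + 1) (j + 1)) (Fin.last n) 0 := by
        rw [mul_smul, mul_smul, mul_smul]
        rw [show AffineWeyl.s n (Fin.ofNat (n + 1) (j + 1)) •
          simpleRoot n (Fin.ofNat (n + 1) (j + 1)) = -simpleRoot n (Fin.ofNat (n + 1) (j + 1))
            from (affinePositiveSystem n).smul_root _,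
          smul_neg, upWord_smul_simpleRoot hj', smul_neg, sElem_smul, pairing_highestRoot]
        congr 1
        have h0 := zero_ne_last (n := n)
        have h1 : Fin.ofNat (n + 1) (j + 1) ≠ 0 := by
          rw [ofNat_add_one hj']
          exact Fin.succ_ne_zero _
        generalize Fin.ofNat (n + 1) (j + 1) = p at h1 hlast
        refine Prod.ext (Subtype.ext ?_) (Prod.ext ?_ ?_) <;>
          simp [affRoot, finRoot, highestRoot, h0.symm, h1.symm, hlast.symm]
      exact e ▸ hz _ hlast
    · rw [← mul_assoc, mul_assoc _ _ (AffineWeyl.s n _), h2, mul_one]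
      exact ih hj'

/-- For `x` in the finite Weyl group, the word of `s_0 s_θ` ascends from `x w_k`. -/
theorem ascends_periodWord {x : AffineWeyl n} (hx : x ∈ finiteWeyl n) (k : ℕ) :
    (affinePositiveSystem n).Ascends (x * wElem n k) (periodWord n) := by
  have hz : ∀ a b, a ≠ b → (a = 0 ∨ b = Fin.last n) →
      (affinePositiveSystem n).Pos ((x * wElem n k * AffineWeyl.s n 0) • affRoot n a b 0) :=
    fun a b hab h => by
      rw [mul_smul]
      exact (isStable_s_zero_smul hab h).pos hx k
  refine ⟨isStable_simpleRoot_zero.pos hx k, PositiveSystem.ascends_append _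
    (ascends_upWord (fun b hb => hz 0 b hb (Or.inl rfl)) n le_rfl) ?_⟩
  have e : ((upWord n n).map (AffineWeyl.s n)).prod =
      sElem n (n - 1) 1 * ((upWord n (n - 1)).map (AffineWeyl.s n)).prod := by
    rw [sElem_eq_conj, upWord_self]
    simp
  rw [e, ← mul_assoc]
  exact ascends_reverse_upWord (fun a ha => hz a _ ha (Or.inr rfl)) _
    (Nat.sub_lt (Nat.pos_of_ne_zero (NeZero.ne n)) one_pos)

theorem strictMono_mul_wElem {x : AffineWeyl n} (hx : x ∈ finiteWeyl n) :
    StrictMono fun k : ℕ => x * wElem n k := by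
  refine strictMono_nat_of_lt_succ fun k => ?_
  have h := ascends_periodWord hx k
  have e : x * wElem n (k + 1) =
      x * wElem n k * ((periodWord n).map (AffineWeyl.s n)).prod := by
    rw [prod_periodWord, wElem, wElem, pow_succ, mul_assoc]
  have hle : x * wElem n k ≤ x * wElem n (k + 1) := by
    rw [e]
    exact PositiveSystem.Ascends.bruhatLE _ h
  refine lt_of_le_of_ne hle fun heq => ?_
  have hlt := PositiveSystem.Ascends.genLength_lt _ h (List.cons_ne_nil _ _)
  rw [← e, ← heq] at hlt
  exact lt_irrefl _ hlt

theorem isCofinal_range_mul_wElem {x : AffineWeyl n} (hx : x ∈ finiteWeyl n) :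
    IsCofinal (Set.range fun k : ℕ => x * wElem n k) := by
  intro a
  obtain ⟨k, hk⟩ := (affinePositiveSystem n).exists_bruhatLE_mul_pow (x := x) mem_periodWord
    (fun k => by
      rw [prod_periodWord]
      exact ascends_periodWord hx k) a
  rw [prod_periodWord] at hk
  exact ⟨_, ⟨k, rfl⟩, hk⟩

end Cofinal

theorem mainTheorem6 (n : ℕ) [NeZero n] :
    (StrictMono (fun k : ℕ => wElem n k) ∧
      IsCofinal (Set.range fun k : ℕ => wElem n k)) ∧
    ∀ w₀ : AffineWeyl n, IsLongestElement n w₀ →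
      (StrictMono (fun k : ℕ => w₀ * wElem n k) ∧
        IsCofinal (Set.range fun k : ℕ => w₀ * wElem n k)) := by
  refine ⟨?_, fun w₀ h => ⟨strictMono_mul_wElem h.1, isCofinal_range_mul_wElem h.1⟩⟩
  have h1 := strictMono_mul_wElem (n := n) (one_mem _)
  have h2 := isCofinal_range_mul_wElem (n := n) (one_mem _)
  simp only [one_mul] at h1 h2
  exact ⟨h1, h2⟩
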